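/- Let $E$ be a finite set and let $f:2^E\to\mathbb{R}$ be the rank function of a polymatroid, that is, $f(\emptyset)=0$, $f\ge 0$, $f(A)\le f(B)$ whenever $A\subseteq B\subseteq E$, and $f(A\cup B)+f(A\cap B)\le f(A)+f(B)$ for all $A,B\subseteq E$. For such a function put $$\mathcal P(f)=\Big\{x\in\mathbb{R}_{\ge 0}^E : \sum_{i\in A}x_i\le f(A)\ \text{for all } A\subseteq E\Big\},\qquad \mathcal B(f)=\Big\{x\in\mathcal P(f):\sum_{i\in E}x_i=f(E)\Big\}.$$ Let $v\in\mathbb{R}^E$ with $v_i>0$ for all $i$, let $\mathcal X^*$ be the set of maximizers of $\sum_{i\in E}v_ix_i$ over $x\in\mathcal P(f)$, and let $\mathcal U=\{(v_ix_i)_{i\in E} : x\in\mathcal X^*\}$. Let $w_1>w_2>\dots>w_k>0$ be the distinct values of the coordinates of $v$, and put $E_j=\{i\in E: v_i=w_j\}$ and $P_{<j}=E_1\cup\dots\cup E_{j-1}$. Define, for $S\subseteq E$, $$g(S)=\sum_{j=1}^k w_j\big[f(P_{<j}\cup(S\cap E_j))-f(P_{<j})\big].$$ Then $g$ is again the rank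 function of a polymatroid (it is non-negative, monotone and submodular, with $g(\emptyset)=0$), it is the saturation function of $\mathcal U$, i.e. $g(S)=\max_{u\in\mathcal U}\sum_{i\in S}u_i$ for every $S\subseteq E$ (the maximum being attained), and $\mathcal U=\mathcal B(g)$. -/

import Mathlib

/-!
Abel summation (the layer-cake formula) writes `∑ v i * x i` as a combination, with positive
coefficients, of the sums of `x` over the superlevel sets `{v > t}`, `t ≥ 0`. Each of these sums is
at most `f {v > t}`, and the greedy algorithm, run in decreasing order of `v`, attains all these
bounds at once. Hence `x` is optimal if and only if it is tight on every superlevel set of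
non-negative height, and then its sum over `S ∩ E_j` is at most the gain of `f` from adding
`S ∩ E_j` to `P_{<j}`. Breaking the ties of the greedy algorithm in favour of `S` attains all of
these bounds, so `g` is the saturation function. Conversely, a base `u` of `g` satisfies
`u(A ∩ E_j) / w_j ≤ f (P_{<j} ∪ (A ∩ E_j)) - f P_{<j}`. By submodularity these gains add up, over
all `j`, to at most `f A`, so `u / v` lies in the polytope of `f`, and it is optimal since its
welfare is `g E`.
-/

namespace PolymatroidUtility

variable {E : Type*} [Fintype E] [DecidableEq E]

/-- `f` is the rank function of a polymatroid on the finite ground set `E`: a normalized,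
non-negative, monotone, submodular set function. -/
structure IsPolymatroidRank (f : Finset E → ℝ) : Prop where
  empty : f ∅ = 0
  nonneg : ∀ A, 0 ≤ f A
  mono : ∀ A B, A ⊆ B → f A ≤ f B
  submodular : ∀ A B, f (A ∪ B) + f (A ∩ B) ≤ f A + f B

/-- The independence polytope `P(f)`, a subset of the non-negative orthant. -/
def indepPolytope (f : Finset E → ℝ) : Set (E → ℝ) :=
  {x | (∀ i, 0 ≤ x i) ∧ ∀ A : Finset E, ∑ i ∈ A, x i ≤ f A}

/-- The base polytope `B(f)`: the points `x` of `P(f)` with `x(E) = f(E)`. -/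
def basePolytope (f : Finset E → ℝ) : Set (E → ℝ) :=
  {x | x ∈ indepPolytope f ∧ ∑ i, x i = f Finset.univ}

/-- The face of welfare-maximizing allocations: the maximizers of `v · x` over `P(f)`. -/
def optimalAllocations (f : Finset E → ℝ) (v : E → ℝ) : Set (E → ℝ) :=
  {x | x ∈ indepPolytope f ∧ ∀ y ∈ indepPolytope f, ∑ i, v i * y i ≤ ∑ i, v i * x i}

/-- The utility vectors `(v i * x i)` of the welfare-maximizing allocations `x`. -/
def utilityVectors (f : Finset E → ℝ) (v : E → ℝ) : Set (E → ℝ) :=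
  (fun x i => v i * x i) '' optimalAllocations f v

/-- The set of distinct values taken by `v`. -/
noncomputable def distinctValues (v : E → ℝ) : Finset ℝ :=
  Finset.univ.image v

/-- The block of all agents whose value is `w`. -/
noncomputable def block (v : E → ℝ) (w : ℝ) : Finset E :=
  Finset.univ.filter fun i => v i = w

/-- The union of all blocks of value strictly larger than `w`; it is `P_{<j}` when `w` is the
`j`-th largest of the distinct values. -/
noncomputable def higherBlocks (v : E → ℝ) (w : ℝ) : Finset E :=
  ((distinctValues v).filter fun w' => w < w').biUnion (block v)

end PolymatroidUtility

namespace PolymatroidUtility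

section General

variable {E : Type*} [DecidableEq E] {f : Finset E → ℝ}

theorem IsPolymatroidRank.contract (hf : IsPolymatroidRank f) (H B : Finset E) :
    IsPolymatroidRank fun S => f (H ∪ (S ∩ B)) - f H where
  empty := by simp
  nonneg S := sub_nonneg.2 (hf.mono _ _ Finset.subset_union_left)
  mono S T hST := sub_le_sub_right (hf.mono _ _ (by gcongr)) _
  submodular S T := by
    have h := hf.submodular (H ∪ (S ∩ B)) (H ∪ (T ∩ B))
    rw [← Finset.union_union_distrib_left, ← Finset.union_inter_distrib_left,
      ← Finset.union_inter_distrib_right, ← Finset.inter_inter_distrib_right] at h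
    linarith

theorem isPolymatroidRank_sum_mul {ι : Type*} {s : Finset ι} {c : ι → ℝ}
    {r : ι → Finset E → ℝ} (hc : ∀ w ∈ s, 0 ≤ c w) (hr : ∀ w ∈ s, IsPolymatroidRank (r w)) :
    IsPolymatroidRank fun S => ∑ w ∈ s, c w * r w S where
  empty := Finset.sum_eq_zero fun w hw => by rw [(hr w hw).empty, mul_zero]
  nonneg S := Finset.sum_nonneg fun w hw => mul_nonneg (hc w hw) ((hr w hw).nonneg S)
  mono S T hST := Finset.sum_le_sum fun w hw =>
    mul_le_mul_of_nonneg_left ((hr w hw).mono S T hST) (hc w hw)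
  submodular S T := by
    simp only [← Finset.sum_add_distrib, ← mul_add]
    exact Finset.sum_le_sum fun w hw =>
      mul_le_mul_of_nonneg_left ((hr w hw).submodular S T) (hc w hw)

/-- `U` is an upper set for the preorder on `E` in which `i` lies below `j` when `p i ≤ p j`;
these are the sets served first when the elements are processed in decreasing order of `p`. -/
def IsUpperUnder {α : Type*} [LE α] (p : E → α) (U : Finset E) : Prop :=
  ∀ ⦃i j⦄, i ∈ U → p i ≤ p j → j ∈ U

theorem IsPolymatroidRank.exists_greedy_inter {α : Type*} [LinearOrder α]
    (hf : IsPolymatroidRank f) (p : E → α) (s : Finset E) :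
    ∃ x ∈ indepPolytope fun A => f (A ∩ s),
      ∀ U, IsUpperUnder p U → ∑ i ∈ U, x i = f (U ∩ s) := by
  induction s using Finset.induction_on_min_value p with
  | empty => exact ⟨0, by simp [indepPolytope, hf.empty], by simp [hf.empty]⟩
  | insert a s _ hmin ih =>
    obtain ⟨x, ⟨hx_nonneg, hx_le⟩, hx_tight⟩ := ih
    set m : ℝ := f (insert a s) - f s
    have hm : (0 : E → ℝ) ≤ Pi.single a m :=
      Pi.single_nonneg.2 (sub_nonneg.2 (hf.mono _ _ (Finset.subset_insert a s)))
    have hsum (A : Finset E) :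
        ∑ i ∈ A, (x + Pi.single a m : E → ℝ) i = ∑ i ∈ A, x i + if a ∈ A then m else 0 := by
      simp only [Pi.add_apply, Finset.sum_add_distrib, Finset.sum_pi_single']
    refine ⟨x + Pi.single a m, ⟨?nonneg, fun A => ?indep⟩, fun U hU => ?tight⟩
    case nonneg => exact fun i => add_nonneg (hx_nonneg i) (hm i)
    case indep =>
      change _ ≤ f (A ∩ insert a s)
      rw [hsum]
      split_ifs with haA
      · have hsub := hf.submodular (A ∩ insert a s) s
        rw [show A ∩ insert a s ∪ s = insert a s by grind,
          show A ∩ insert a s ∩ s = A ∩ s by grind] at hsub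
        linarith [hx_le A]
      · rw [Finset.inter_insert_of_notMem haA, add_zero]
        exact hx_le A
    case tight =>
      rw [hsum, hx_tight U hU]
      split_ifs with haU
      · have hsU : s ⊆ U := fun j hj => hU haU (hmin j hj)
        rw [Finset.inter_eq_right.2 hsU,
          Finset.inter_eq_right.2 (Finset.insert_subset haU hsU), add_sub_cancel]
      · rw [Finset.inter_insert_of_notMem haU, add_zero]

theorem IsPolymatroidRank.exists_greedy [Finite E] {α : Type*} [LinearOrder α]
    (hf : IsPolymatroidRank f) (p : E → α) :
    ∃ x ∈ indepPolytope f, ∀ U, IsUpperUnder p U → ∑ i ∈ U, x i = f U := by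
  cases nonempty_fintype E
  simpa only [Finset.inter_univ] using hf.exists_greedy_inter p Finset.univ

end General

section LinearOrder

variable {α : Type*} [LinearOrder α]

theorem sum_sub_filter_lt_telescope {M : Type*} [AddCommGroup M] (φ : Finset α → M)
    (T : Finset α) :
    ∑ w ∈ T, (φ {u ∈ T | w ≤ u} - φ {u ∈ T | w < u}) = φ T - φ ∅ := by
  induction T using Finset.induction_on_min with
  | empty => simp
  | insert a s hlt ih =>
    have hle : {u ∈ insert a s | a ≤ u} = insert a s := by grind
    have hgt : {u ∈ insert a s | a < u} = s := by grind
    have hrest : ∀ w ∈ s, φ {u ∈ insert a s | w ≤ u} - φ {u ∈ insert a s | w < u} =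
        φ {u ∈ s | w ≤ u} - φ {u ∈ s | w < u} := fun w hw => by
      rw [Finset.filter_insert, Finset.filter_insert, if_neg (hlt w hw).not_ge,
        if_neg (hlt w hw).not_gt]
    rw [Finset.sum_insert fun ha => (hlt a ha).false, Finset.sum_congr rfl hrest, ih, hle, hgt,
      sub_add_sub_cancel]

theorem exists_pos_increments [AddCommGroup α] [IsOrderedAddMonoid α] [Nontrivial α]
    (T : Finset α) {c : α} (hc : ∀ w ∈ T, c ≤ w) :
    ∃ δ : α → α, (∀ t, 0 < δ t) ∧ ∀ w ∈ T, ∑ t ∈ insert c T with t < w, δ t = w - c := by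
  induction T using Finset.induction_on_min generalizing c with
  | empty =>
    obtain ⟨b, hb⟩ := exists_zero_lt (α := α)
    exact ⟨fun _ => b, fun _ => hb, by simp⟩
  | insert a s hlt ih =>
    obtain ⟨δ, hδ_pos, hδ_sum⟩ := ih fun w hw => (hlt w hw).le
    rcases (hc a (Finset.mem_insert_self a s)).eq_or_lt with rfl | hca
    · refine ⟨δ, hδ_pos, fun w hw => ?_⟩
      rw [Finset.insert_idem]
      rcases Finset.mem_insert.1 hw with rfl | hw
      · rw [sub_self]
        exact Finset.sum_eq_zero fun t ht => by grind
      · exact hδ_sum w hw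
    · have hcs : c ∉ insert a s := by grind
      refine ⟨Function.update δ c (a - c), fun t => ?_, fun w hw => ?_⟩
      · rcases eq_or_ne t c with rfl | htc
        · simpa using hca
        · simpa [htc] using hδ_pos t
      · have hcw : c < w := by grind
        have hsum : ∑ t ∈ insert a s with t < w, δ t = w - a := by
          rcases Finset.mem_insert.1 hw with rfl | hw
          · rw [sub_self]
            exact Finset.sum_eq_zero fun t ht => by grind
          · exact hδ_sum w hw
        rw [Finset.filter_insert, if_pos hcw, Finset.sum_insert (by grind),
          Function.update_self, Finset.sum_update_of_notMem (by grind), hsum]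
        abel

end LinearOrder

section Blocks

variable {E : Type*} [Fintype E] {v : E → ℝ} {w t : ℝ} {i : E}

theorem mem_block : i ∈ block v w ↔ v i = w := by
  simp [block]

theorem nonneg_of_mem_distinctValues (hv : ∀ i, 0 ≤ v i) (hw : w ∈ distinctValues v) :
    0 ≤ w := by
  obtain ⟨i, -, rfl⟩ := Finset.mem_image.1 hw
  exact hv i

variable [DecidableEq E]

theorem biUnion_block_distinctValues (v : E → ℝ) :
    (distinctValues v).biUnion (block v) = Finset.univ := by
  ext i
  simp [distinctValues, mem_block]

theorem mem_higherBlocks : i ∈ higherBlocks v t ↔ t < v i := by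
  simp [higherBlocks, distinctValues, mem_block]

theorem disjoint_higherBlocks_block (v : E → ℝ) (w : ℝ) :
    Disjoint (higherBlocks v w) (block v w) :=
  Finset.disjoint_left.2 fun _ hi hi' => (mem_higherBlocks.1 hi).ne' (mem_block.1 hi')

theorem biUnion_block_filter_le (v : E → ℝ) (w : ℝ) :
    {w' ∈ distinctValues v | w ≤ w'}.biUnion (block v) = higherBlocks v w ∪ block v w := by
  ext i
  simp [distinctValues, mem_higherBlocks, mem_block, le_iff_lt_or_eq, eq_comm]

theorem sum_distinctValues_sum_inter_block (v x : E → ℝ) (S : Finset E) :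
    ∑ w ∈ distinctValues v, ∑ i ∈ S ∩ block v w, x i = ∑ i ∈ S, x i := by
  rw [← Finset.sum_fiberwise_of_maps_to (t := distinctValues v) (g := v)
    fun i _ => Finset.mem_image_of_mem v (Finset.mem_univ i)]
  simp only [block, Finset.inter_filter, Finset.inter_univ]

theorem sum_mul_eq_sum_distinctValues_mul (v x : E → ℝ) (S : Finset E) :
    ∑ i ∈ S, v i * x i = ∑ w ∈ distinctValues v, w * ∑ i ∈ S ∩ block v w, x i := by
  rw [← sum_distinctValues_sum_inter_block v]
  refine Finset.sum_congr rfl fun w _ => ?_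
  rw [Finset.mul_sum]
  refine Finset.sum_congr rfl fun i hi => ?_
  rw [mem_block.1 (Finset.mem_inter.1 hi).2]

theorem exists_layer_cake (hv : ∀ i, 0 ≤ v i) (ht : 0 ≤ t) :
    ∃ (T : Finset ℝ) (δ : ℝ → ℝ), t ∈ T ∧ (∀ s ∈ T, 0 ≤ s) ∧ (∀ s, 0 < δ s) ∧
      ∀ x : E → ℝ, ∑ i, v i * x i = ∑ s ∈ T, δ s * ∑ i ∈ higherBlocks v s, x i := by
  have hnonneg : ∀ s ∈ insert t (distinctValues v), 0 ≤ s :=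
    Finset.forall_mem_insert .. |>.2 ⟨ht, fun _ => nonneg_of_mem_distinctValues hv⟩
  obtain ⟨δ, hδ_pos, hδ_sum⟩ := exists_pos_increments _ hnonneg
  refine ⟨insert 0 (insert t (distinctValues v)), δ, by simp,
    Finset.forall_mem_insert .. |>.2 ⟨le_rfl, hnonneg⟩, hδ_pos, fun x => ?_⟩
  have hv_eq (i : E) : v i = ∑ s ∈ insert 0 (insert t (distinctValues v)) with s < v i, δ s := by
    rw [hδ_sum (v i) (by simp [distinctValues]), sub_zero]
  calc ∑ i, v i * x i
      = ∑ i, ∑ s ∈ insert 0 (insert t (distinctValues v)) with s < v i, δ s * x i := by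
        simp only [← Finset.sum_mul, ← hv_eq]
    _ = ∑ s ∈ insert 0 (insert t (distinctValues v)), ∑ i ∈ higherBlocks v s, δ s * x i :=
        Finset.sum_comm' fun i s => by simp [mem_higherBlocks, and_comm]
    _ = _ := by simp only [Finset.mul_sum]

end Blocks

section Optimality

variable {E : Type*} [Fintype E] [DecidableEq E] {f : Finset E → ℝ} {v x y : E → ℝ}

/-- The constraints of `indepPolytope f` on the superlevel sets `{v > t}`, `t ≥ 0`, hold with
equality at `x`. This characterizes the optimal allocations among the points of the polytope. -/
def TightOnSuperlevels (f : Finset E → ℝ) (v x : E → ℝ) : Prop :=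
  ∀ t, 0 ≤ t → ∑ i ∈ higherBlocks v t, x i = f (higherBlocks v t)

theorem TightOnSuperlevels.sum_mul_le (hy : TightOnSuperlevels f v y) (hv : ∀ i, 0 ≤ v i)
    (hx : x ∈ indepPolytope f) : ∑ i, v i * x i ≤ ∑ i, v i * y i := by
  obtain ⟨T, δ, -, hT, hδ, hlayer⟩ := exists_layer_cake hv le_rfl
  rw [hlayer x, hlayer y]
  refine Finset.sum_le_sum fun s hs => mul_le_mul_of_nonneg_left ?_ (hδ s).le
  rw [hy s (hT s hs)]
  exact hx.2 _

theorem TightOnSuperlevels.of_sum_mul_eq (hy : TightOnSuperlevels f v y) (hv : ∀ i, 0 ≤ v i)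
    (hx : x ∈ indepPolytope f) (hxy : ∑ i, v i * x i = ∑ i, v i * y i) :
    TightOnSuperlevels f v x := by
  intro t ht
  obtain ⟨T, δ, htT, hT, hδ, hlayer⟩ := exists_layer_cake hv ht
  have hle : ∀ s ∈ T, δ s * ∑ i ∈ higherBlocks v s, x i ≤
      δ s * ∑ i ∈ higherBlocks v s, y i := fun s hs => by
    rw [hy s (hT s hs)]
    exact mul_le_mul_of_nonneg_left (hx.2 _) (hδ s).le
  rw [hlayer x, hlayer y, Finset.sum_eq_sum_iff_of_le hle] at hxy
  rw [mul_left_cancel₀ (hδ t).ne' (hxy t htT), hy t ht]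

theorem IsPolymatroidRank.exists_tightOnSuperlevels (hf : IsPolymatroidRank f) (v : E → ℝ)
    (S : Finset E) :
    ∃ x ∈ indepPolytope f, TightOnSuperlevels f v x ∧ ∀ w,
      ∑ i ∈ higherBlocks v w ∪ (S ∩ block v w), x i = f (higherBlocks v w ∪ (S ∩ block v w)) := by
  obtain ⟨x, hx, htight⟩ :=
    hf.exists_greedy fun i => (toLex (v i, if i ∈ S then 1 else 0) : ℝ ×ₗ ℕ)
  refine ⟨x, hx, fun t _ => htight _ fun i j hi hij => ?_, fun w => htight _ fun i j hi hij => ?_⟩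
  all_goals
    rw [Prod.Lex.toLex_le_toLex] at hij
    simp only [Finset.mem_union, Finset.mem_inter, mem_higherBlocks, mem_block] at hi ⊢
    grind

theorem mem_optimalAllocations_iff (hf : IsPolymatroidRank f) (hv : ∀ i, 0 ≤ v i) :
    x ∈ optimalAllocations f v ↔ x ∈ indepPolytope f ∧ TightOnSuperlevels f v x := by
  refine ⟨fun hx => ⟨hx.1, ?_⟩, fun hx => ⟨hx.1, fun y hy => hx.2.sum_mul_le hv hy⟩⟩
  obtain ⟨y, hy, hy_tight, -⟩ := hf.exists_tightOnSuperlevels v ∅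
  exact hy_tight.of_sum_mul_eq hv hx.1 ((hy_tight.sum_mul_le hv hx.1).antisymm (hx.2 y hy))

end Optimality

section UtilityRank

variable {E : Type*} [Fintype E] [DecidableEq E] {f : Finset E → ℝ} {v x u : E → ℝ} {w : ℝ}

/-- The rank of `S ∩ E_j` after contracting `P_{<j}`, for `w = w_j`: the most that the agents of
`S ∩ E_j` can get once the blocks of higher value have received all they can. -/
noncomputable def blockRank (f : Finset E → ℝ) (v : E → ℝ) (w : ℝ) (S : Finset E) : ℝ :=
  f (higherBlocks v w ∪ (S ∩ block v w)) - f (higherBlocks v w)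

/-- The saturation function `g` of the utility vectors, in closed form. -/
noncomputable def utilityRank (f : Finset E → ℝ) (v : E → ℝ) (S : Finset E) : ℝ :=
  ∑ w ∈ distinctValues v, w * blockRank f v w S

theorem isPolymatroidRank_blockRank (hf : IsPolymatroidRank f) (v : E → ℝ) (w : ℝ) :
    IsPolymatroidRank (blockRank f v w) :=
  hf.contract _ _

theorem isPolymatroidRank_utilityRank (hf : IsPolymatroidRank f) (hv : ∀ i, 0 ≤ v i) :
    IsPolymatroidRank (utilityRank f v) :=
  isPolymatroidRank_sum_mul (fun _ => nonneg_of_mem_distinctValues hv)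
    fun w _ => isPolymatroidRank_blockRank hf v w

theorem sum_blockRank_le (hf : IsPolymatroidRank f) (v : E → ℝ) (A : Finset E) :
    ∑ w ∈ distinctValues v, blockRank f v w A ≤ f A := by
  have hblock : ∀ w ∈ distinctValues v, blockRank f v w A ≤
      f (A ∩ {w' ∈ distinctValues v | w ≤ w'}.biUnion (block v)) -
        f (A ∩ higherBlocks v w) := fun w _ => by
    have h := hf.submodular (higherBlocks v w) (A ∩ (higherBlocks v w ∪ block v w))
    rw [show higherBlocks v w ∪ A ∩ (higherBlocks v w ∪ block v w) =
        higherBlocks v w ∪ (A ∩ block v w) by grind,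
      show higherBlocks v w ∩ (A ∩ (higherBlocks v w ∪ block v w)) =
        A ∩ higherBlocks v w by grind] at h
    rw [biUnion_block_filter_le, blockRank]
    linarith
  calc ∑ w ∈ distinctValues v, blockRank f v w A
      ≤ ∑ w ∈ distinctValues v, (f (A ∩ {w' ∈ distinctValues v | w ≤ w'}.biUnion (block v)) -
          f (A ∩ higherBlocks v w)) := Finset.sum_le_sum hblock
    _ = f (A ∩ (distinctValues v).biUnion (block v)) - f (A ∩ (∅ : Finset ℝ).biUnion (block v)) :=
        sum_sub_filter_lt_telescope (fun T => f (A ∩ T.biUnion (block v))) _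
    _ = f A := by simp [biUnion_block_distinctValues, hf.empty]

theorem TightOnSuperlevels.sum_inter_block_eq (hx : TightOnSuperlevels f v x) (hw : 0 ≤ w)
    (S : Finset E) :
    ∑ i ∈ S ∩ block v w, x i =
      ∑ i ∈ higherBlocks v w ∪ (S ∩ block v w), x i - f (higherBlocks v w) := by
  rw [Finset.sum_union ((disjoint_higherBlocks_block v w).mono_right Finset.inter_subset_right),
    hx w hw, add_sub_cancel_left]

theorem TightOnSuperlevels.sum_mul_le_utilityRank (hx_tight : TightOnSuperlevels f v x)
    (hv : ∀ i, 0 ≤ v i) (hx : x ∈ indepPolytope f) (S : Finset E) :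
    ∑ i ∈ S, v i * x i ≤ utilityRank f v S := by
  rw [sum_mul_eq_sum_distinctValues_mul]
  refine Finset.sum_le_sum fun w hw => ?_
  have hw₀ := nonneg_of_mem_distinctValues hv hw
  rw [hx_tight.sum_inter_block_eq hw₀]
  exact mul_le_mul_of_nonneg_left (sub_le_sub_right (hx.2 _) _) hw₀

theorem exists_optimal_sum_mul_eq_utilityRank (hf : IsPolymatroidRank f) (hv : ∀ i, 0 ≤ v i)
    (S : Finset E) : ∃ x ∈ optimalAllocations f v, ∑ i ∈ S, v i * x i = utilityRank f v S := by
  obtain ⟨x, hx, hx_tight, hx_block⟩ := hf.exists_tightOnSuperlevels v S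
  refine ⟨x, (mem_optimalAllocations_iff hf hv).2 ⟨hx, hx_tight⟩, ?_⟩
  rw [sum_mul_eq_sum_distinctValues_mul]
  refine Finset.sum_congr rfl fun w hw => ?_
  rw [hx_tight.sum_inter_block_eq (nonneg_of_mem_distinctValues hv hw), hx_block, blockRank]

theorem isGreatest_utilityRank (hf : IsPolymatroidRank f) (hv : ∀ i, 0 ≤ v i) (S : Finset E) :
    IsGreatest ((fun u : E → ℝ => ∑ i ∈ S, u i) '' utilityVectors f v) (utilityRank f v S) := by
  constructor
  · obtain ⟨x, hx, hx_sum⟩ := exists_optimal_sum_mul_eq_utilityRank hf hv S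
    exact ⟨_, ⟨x, hx, rfl⟩, hx_sum⟩
  · rintro _ ⟨_, ⟨x, hx, rfl⟩, rfl⟩
    obtain ⟨hx_indep, hx_tight⟩ := (mem_optimalAllocations_iff hf hv).1 hx
    exact hx_tight.sum_mul_le_utilityRank hv hx_indep S

theorem mem_optimalAllocations_iff_sum_eq (hf : IsPolymatroidRank f) (hv : ∀ i, 0 ≤ v i) :
    x ∈ optimalAllocations f v ↔
      x ∈ indepPolytope f ∧ ∑ i, v i * x i = utilityRank f v Finset.univ := by
  obtain ⟨y, hy, hy_sum⟩ := exists_optimal_sum_mul_eq_utilityRank hf hv Finset.univ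
  rw [← hy_sum]
  exact ⟨fun hx => ⟨hx.1, (hy.2 x hx.1).antisymm (hx.2 y hy.1)⟩,
    fun hx => ⟨hx.1, fun z hz => (hy.2 z hz).trans_eq hx.2.symm⟩⟩

theorem utilityRank_inter_block (f : Finset E → ℝ) (A : Finset E) (hw : w ∈ distinctValues v) :
    utilityRank f v (A ∩ block v w) = w * blockRank f v w A := by
  have hother : ∀ w' ∈ distinctValues v, w' ≠ w → w' * blockRank f v w' (A ∩ block v w) = 0 :=
    fun w' _ hne => by
      have hempty : A ∩ block v w ∩ block v w' = ∅ := by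
        ext i
        grind [mem_block]
      rw [blockRank, hempty, Finset.union_empty, sub_self, mul_zero]
  rw [utilityRank, Finset.sum_eq_single_of_mem w hw hother, blockRank, blockRank,
    Finset.inter_assoc, Finset.inter_self]

theorem sum_inter_block_le_mul_blockRank (hu : u ∈ indepPolytope (utilityRank f v))
    (A : Finset E) (hw : w ∈ distinctValues v) :
    ∑ i ∈ A ∩ block v w, u i ≤ w * blockRank f v w A :=
  (hu.2 _).trans_eq (utilityRank_inter_block f A hw)

theorem div_mem_indepPolytope (hf : IsPolymatroidRank f) (hv : ∀ i, 0 ≤ v i)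
    (hu : u ∈ indepPolytope (utilityRank f v)) : (fun i => u i / v i) ∈ indepPolytope f := by
  refine ⟨fun i => div_nonneg (hu.1 i) (hv i), fun A => le_trans ?_ (sum_blockRank_le hf v A)⟩
  rw [← sum_distinctValues_sum_inter_block v]
  refine Finset.sum_le_sum fun w hw => ?_
  calc ∑ i ∈ A ∩ block v w, u i / v i
      = (∑ i ∈ A ∩ block v w, u i) / w := by
        rw [Finset.sum_div]
        exact Finset.sum_congr rfl fun i hi => by rw [mem_block.1 (Finset.mem_inter.1 hi).2]
    _ ≤ blockRank f v w A :=
        div_le_of_le_mul₀ (nonneg_of_mem_distinctValues hv hw)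
          ((isPolymatroidRank_blockRank hf v w).nonneg A)
          ((sum_inter_block_le_mul_blockRank hu A hw).trans_eq (mul_comm _ _))

theorem mul_div_cancel_of_mem_indepPolytope (hu : u ∈ indepPolytope (utilityRank f v)) (i : E) :
    v i * (u i / v i) = u i := by
  refine mul_div_cancel_of_imp' fun hvi => (hu.1 i).antisymm' ?_
  have h := sum_inter_block_le_mul_blockRank hu {i}
    (Finset.mem_image_of_mem v (Finset.mem_univ i))
  rwa [Finset.singleton_inter_of_mem (mem_block.2 rfl), Finset.sum_singleton, hvi, zero_mul] at h

theorem utilityVectors_eq_basePolytope (hf : IsPolymatroidRank f) (hv : ∀ i, 0 ≤ v i) :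
    utilityVectors f v = basePolytope (utilityRank f v) := by
  refine Set.Subset.antisymm ?_ fun u hu => ?_
  · rintro _ ⟨x, hx, rfl⟩
    have hx_tight := ((mem_optimalAllocations_iff hf hv).1 hx).2
    exact ⟨⟨fun i => mul_nonneg (hv i) (hx.1.1 i), hx_tight.sum_mul_le_utilityRank hv hx.1⟩,
      ((mem_optimalAllocations_iff_sum_eq hf hv).1 hx).2⟩
  · have hcancel := mul_div_cancel_of_mem_indepPolytope hu.1
    refine ⟨fun i => u i / v i, (mem_optimalAllocations_iff_sum_eq hf hv).2
      ⟨div_mem_indepPolytope hf hv hu.1, ?_⟩, funext hcancel⟩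
    simp only [hcancel, hu.2]

end UtilityRank

end PolymatroidUtility

/-- The utility vectors of the welfare-maximizing allocations form the base polytope of a
polymatroid rank function `g`, which is given in closed form and is the saturation function of
the set of utility vectors. -/
theorem mainTheorem2 {E : Type*} [Fintype E] [DecidableEq E]
    (f : Finset E → ℝ) (hf : PolymatroidUtility.IsPolymatroidRank f)
    (v : E → ℝ) (hv : ∀ i, 0 < v i) :
    ∃ g : Finset E → ℝ,
      PolymatroidUtility.IsPolymatroidRank g ∧
      (∀ S : Finset E, g S = ∑ w ∈ PolymatroidUtility.distinctValues v,
        w * (f (PolymatroidUtility.higherBlocks v w ∪ (S ∩ PolymatroidUtility.block v w)) -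
          f (PolymatroidUtility.higherBlocks v w))) ∧
      (∀ S : Finset E, IsGreatest
        ((fun u : E → ℝ => ∑ i ∈ S, u i) '' PolymatroidUtility.utilityVectors f v) (g S)) ∧
      PolymatroidUtility.utilityVectors f v = PolymatroidUtility.basePolytope g :=
  have hv₀ : ∀ i, 0 ≤ v i := fun i => (hv i).le
  ⟨PolymatroidUtility.utilityRank f v, PolymatroidUtility.isPolymatroidRank_utilityRank hf hv₀,
    fun _ => rfl, PolymatroidUtility.isGreatest_utilityRank hf hv₀,
    PolymatroidUtility.utilityVectors_eq_basePolytope hf hv₀⟩
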